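/- For a real function $g$ and an interval $I$, a solution on $I$ of $\frac{d\eta}{du}=\frac{1}{\eta+g(u)}$ is a function $\eta$ with $\eta(u)+g(u)\neq 0$ and $\eta'(u)=\frac{1}{\eta(u)+g(u)}$ for all $u\in I$ (one-sided derivative at an endpoint belonging to $I$). (a) Let $p\ge 2$ be even. The equation $$\frac{d\eta}{du}=\frac{1}{\eta+u^p}$$ has a solution $\eta_0$ on $(-\infty,0]$ such that $$\eta_0(u)=-u^p-\frac1p\,\frac{1}{u^{p-1}}+O\!\left(\frac{1}{u^{3p-2}}\right),\qquad u\to-\infty,$$ and it is unique: for every $a\le 0$, every solution on $(-\infty,a]$ with this asymptotic expansion coincides with $\eta_0$ on $(-\infty,a]$. Moreover, there is a constant $K>\frac1p$ such that $$-u^p<\eta_0(u)\ \text{ for all } u\le 0,\qquad \eta_0(u)<-u^p-\frac{K}{u^{p-1}}\ \text{ for all } u<0 .$$ (b) Let $p\ge 3$ be odd. The equation $$\frac{d\eta}{du}=\frac{1}{\eta-u^p}$$ has a solution $\eta_0$ on $(-\infty,0]$ such that $$\eta_0(u)=u^p+\frac1p\,\frac{1}{u^{p-1}}+O\!\left(\frac{1}{u^{3p-2}}\right),\qquad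 u\to-\infty,$$ and it is unique: for every $a\le 0$, every solution on $(-\infty,a]$ with this asymptotic expansion coincides with $\eta_0$ on $(-\infty,a]$. Moreover, there is a constant $K>\frac1p$ such that $$u^p<\eta_0(u)\ \text{ for all } u\le 0,\qquad \eta_0(u)<u^p+\frac{K}{u^{p-1}}\ \text{ for all } u<0 .$$ -/

import Mathlib

open Filter Asymptotics

/-- `η` is a solution on the interval `s` of the scalar equation `dη/du = 1 / (η + g u)`.
The right-hand side has to make sense all along the solution, so `η u + g u ≠ 0` is required;
the derivative is one-sided at an endpoint of `s` that belongs to `s`. -/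
def IsSolutionOn (g : ℝ → ℝ) (s : Set ℝ) (η : ℝ → ℝ) : Prop :=
  ∀ u ∈ s, η u + g u ≠ 0 ∧ HasDerivWithinAt η (1 / (η u + g u)) s u

/-- `η u = -u^p - (1/p) / u^(p-1) + O(1 / u^(3p-2))` as `u → -∞`. -/
def HasEvenExpansion (p : ℕ) (η : ℝ → ℝ) : Prop :=
  (fun u : ℝ => η u - (-u ^ p - (1 / (p : ℝ)) * (1 / u ^ (p - 1))))
    =O[atBot] (fun u : ℝ => 1 / u ^ (3 * p - 2))

/-- `η u = u^p + (1/p) / u^(p-1) + O(1 / u^(3p-2))` as `u → -∞`. -/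
def HasOddExpansion (p : ℕ) (η : ℝ → ℝ) : Prop :=
  (fun u : ℝ => η u - (u ^ p + (1 / (p : ℝ)) * (1 / u ^ (p - 1))))
    =O[atBot] (fun u : ℝ => 1 / u ^ (3 * p - 2))

/-!
With `r = -g'`, the gap `y = η + g` between a solution and the curve `η = -g` satisfies the reduced
equation `y' = 1 / y - r`. As `1 / y` decreases in `y`, the distance between two positive solutions
never grows. Two solutions that approach each other at `-∞` therefore coincide, and solutions
started below the nullcline `ν = 1 / r` at ever earlier times form a locally uniform Cauchy
sequence, because there `ν` tends to `0`. Their limit stays below `ν`. If `ν'` is increasing, then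
freezing its value `c = ν' u` makes `ν / (1 + c ν)` a subsolution up to time `u`, so that
`ν - ν' ν ^ 2 ≤ y ≤ ν`. For `g u = (-u) ^ p` one has `ν = 1 / (p (-u) ^ (p - 1))`, and the error
`ν' ν ^ 2` is of order `1 / u ^ (3 * p - 2)`.
-/

open Set Topology

theorem le_max_zero_of_hasDerivWithinAt_nonpos_of_pos {d d' : ℝ → ℝ} {a b : ℝ} (hab : a ≤ b)
    (hd : ∀ x ∈ Icc a b, HasDerivWithinAt d (d' x) (Icc a b) x)
    (hd' : ∀ x ∈ Icc a b, 0 < d x → d' x ≤ 0) : d b ≤ max (d a) 0 := by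
  have fence : ∀ δ > 0, d b ≤ max (d a) 0 + δ * (b - a + 1) := fun δ hδ => by
    refine image_le_of_deriv_right_lt_deriv_boundary' (f := d) (f' := d')
      (B := fun x => max (d a) 0 + δ * (x - a + 1)) (B' := fun _ => δ)
      (fun x hx => (hd x hx).continuousWithinAt)
      (fun x hx => (hd x (Ico_subset_Icc_self hx)).mono_of_mem_nhdsWithin
        (Icc_mem_nhdsGE_of_mem hx)) ?_ (by fun_prop) (fun x _ => ?_) (fun x hx hxB => ?_)
      (right_mem_Icc.2 hab)
    · linarith [le_max_left (d a) 0]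
    · simpa using ((((hasDerivAt_id x).sub_const a).add_const 1).const_mul δ).const_add
        (max (d a) 0) |>.hasDerivWithinAt
    · have hxpos : 0 < δ * (x - a + 1) := mul_pos hδ (by linarith [hx.1])
      have hdx : 0 < d x := by linarith [le_max_right (d a) 0]
      exact (hd' x (Ico_subset_Icc_self hx) hdx).trans_lt hδ
  have hlen : 0 < b - a + 1 := by linarith
  refine le_of_forall_pos_le_add fun ε hε => ?_
  simpa [hlen.ne'] using fence (ε / (b - a + 1)) (by positivity)

/-- `y` is a positive solution on `s` of the reduced equation `y' = 1 / y - r u`. It governs the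
gap `y = η + g` between a solution of `η' = 1 / (η + g u)` and the curve `η = -g`, with
`r = -g'`. -/
def IsReducedSolutionOn (r : ℝ → ℝ) (s : Set ℝ) (y : ℝ → ℝ) : Prop :=
  ∀ u ∈ s, 0 < y u ∧ HasDerivWithinAt y ((y u)⁻¹ - r u) s u

namespace IsReducedSolutionOn

variable {r ρ y z : ℝ → ℝ} {s t : Set ℝ} {a b : ℝ}

theorem mono (hy : IsReducedSolutionOn r t y) (hst : s ⊆ t) : IsReducedSolutionOn r s y :=
  fun u hu => ⟨(hy u (hst hu)).1, (hy u (hst hu)).2.mono hst⟩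

theorem congr (hy : IsReducedSolutionOn r s y) (h : EqOn r ρ s) : IsReducedSolutionOn ρ s y :=
  fun u hu => ⟨(hy u hu).1, h hu ▸ (hy u hu).2⟩

theorem sub_le_max_sub_zero (hab : a ≤ b) (hy : IsReducedSolutionOn r (Icc a b) y)
    (hz : IsReducedSolutionOn r (Icc a b) z) : y b - z b ≤ max (y a - z a) 0 := by
  refine le_max_zero_of_hasDerivWithinAt_nonpos_of_pos (d := y - z) hab
    (fun x hx => (hy x hx).2.sub (hz x hx).2) fun x hx hzy => ?_
  have hinv : (y x)⁻¹ ≤ (z x)⁻¹ := inv_anti₀ (hz x hx).1 (sub_pos.1 hzy).le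
  linarith

theorem abs_sub_le (hab : a ≤ b) (hy : IsReducedSolutionOn r (Icc a b) y)
    (hz : IsReducedSolutionOn r (Icc a b) z) : |y b - z b| ≤ |y a - z a| := by
  refine abs_sub_le_iff.2 ⟨(hy.sub_le_max_sub_zero hab hz).trans ?_,
    (hz.sub_le_max_sub_zero hab hy).trans ?_⟩
  · exact max_le (le_abs_self _) (abs_nonneg _)
  · exact max_le (abs_sub_comm (y a) (z a) ▸ le_abs_self _) (abs_nonneg _)

theorem eqOn_of_tendsto_sub (hy : IsReducedSolutionOn r (Iic a) y)
    (hz : IsReducedSolutionOn r (Iic a) z) (h : Tendsto (fun u => y u - z u) atBot (𝓝 0)) :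
    EqOn y z (Iic a) := by
  intro u hu
  have hle : |y u - z u| ≤ |0| := by
    refine ge_of_tendsto h.abs ((eventually_le_atBot u).mono fun v hvu => ?_)
    have hsub : Icc v u ⊆ Iic a := fun x hx => hx.2.trans hu
    exact (hy.mono hsub).abs_sub_le hvu (hz.mono hsub)
  exact sub_eq_zero.1 (abs_nonpos_iff.1 (abs_zero (α := ℝ) ▸ hle))

/-- Freezing `r` at its final value `r b` makes the constant `1 / r b` a supersolution, so `r` need
not be differentiable. -/
theorem mul_le_one (hab : a ≤ b) (hr : AntitoneOn r (Icc a b)) (hrb : 0 ≤ r b)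
    (hy : IsReducedSolutionOn r (Icc a b) y) (ha : r a * y a ≤ 1) : r b * y b ≤ 1 := by
  have hcmp := le_max_zero_of_hasDerivWithinAt_nonpos_of_pos (d := fun x => r b * y x - 1) hab
    (fun x hx => ((hy x hx).2.const_mul (r b)).sub_const 1) fun x hx hpos => ?_
  · have hra : r b * y a ≤ r a * y a :=
      mul_le_mul_of_nonneg_right (hr (left_mem_Icc.2 hab) (right_mem_Icc.2 hab) hab)
        (hy a (left_mem_Icc.2 hab)).1.le
    rw [max_eq_right (by linarith)] at hcmp
    linarith
  · have hinv : (y x)⁻¹ ≤ r b := (inv_le_iff_one_le_mul₀ (hy x hx).1).2 (by linarith)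
    have hrx : r b ≤ r x := hr hx (right_mem_Icc.2 hab) hx.2
    exact mul_nonpos_of_nonneg_of_nonpos hrb (by linarith)

/-- While `y` lies below the constant `c = 1 / (R + 1)` its slope exceeds `1 ≥ c`, so that `y`
overtakes the line `c (x - (b - 1))` within unit time. -/
theorem inv_add_one_le {R : ℝ} (hR : 0 ≤ R) (hr : ∀ x ∈ Icc (b - 1) b, r x ≤ R)
    (hy : IsReducedSolutionOn r (Icc (b - 1) b) y) : (R + 1)⁻¹ ≤ y b := by
  set c := (R + 1)⁻¹ with hc
  have hc0 : 0 < c := by positivity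
  have hc1 : c ≤ 1 := inv_le_one_of_one_le₀ (by linarith)
  have hcmp := le_max_zero_of_hasDerivWithinAt_nonpos_of_pos (a := b - 1) (b := b)
    (d := fun x => c * (x - (b - 1)) - y x) (by linarith)
    (fun x hx => (((hasDerivWithinAt_id x _).sub_const (b - 1)).const_mul c).sub (hy x hx).2)
    fun x hx hpos => ?_
  · have hyb := (hy (b - 1) ⟨le_rfl, by linarith⟩).1
    rw [max_eq_right (by linarith)] at hcmp
    linarith
  · have hyc : y x ≤ c := by nlinarith [hx.2]
    have hinv : R + 1 ≤ (y x)⁻¹ := by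
      simpa only [hc, inv_inv] using inv_anti₀ (hy x hx).1 hyc
    linarith [hr x hx]

/-- Where `ν' ≤ c`, the function `ν / (1 + c ν)` is a subsolution: its slope is at most `c`, which
is the value of `1 / y - 1 / ν` on it. -/
theorem sub_mul_sq_le {ν ν' : ℝ → ℝ} {c : ℝ} (hc : 0 ≤ c)
    (hν : ∀ u ∈ Iic a, HasDerivWithinAt ν (ν' u) (Iic a) u) (hpos : ∀ u ∈ Iic a, 0 < ν u)
    (hν' : ∀ u ∈ Iic a, ν' u ≤ c) (hlim : Tendsto ν atBot (𝓝 0))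
    (hy : IsReducedSolutionOn ν⁻¹ (Iic a) y) : ν a - c * ν a ^ 2 ≤ y a := by
  have hden : ∀ u ∈ Iic a, 1 ≤ 1 + c * ν u := fun u hu =>
    le_add_of_nonneg_right (mul_nonneg hc (hpos u hu).le)
  set w : ℝ → ℝ := fun u => ν u / (1 + c * ν u) with hw_def
  have hw : ∀ u ∈ Iic a, HasDerivWithinAt w (ν' u / (1 + c * ν u) ^ 2) (Iic a) u := fun u hu => by
    have hne : 1 + c * ν u ≠ 0 := (zero_lt_one.trans_le (hden u hu)).ne'
    refine ((hν u hu).div (((hν u hu).const_mul c).const_add 1) hne).congr_deriv ?_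
    congr 1
    ring
  have hslope : ∀ u ∈ Iic a, ν' u / (1 + c * ν u) ^ 2 ≤ c := fun u hu =>
    (div_le_div_of_nonneg_right (hν' u hu) (sq_nonneg _)).trans
      (div_le_self hc (one_le_pow₀ (hden u hu)))
  have hw_inv : ∀ u ∈ Iic a, (w u)⁻¹ = (ν u)⁻¹ + c := fun u hu => by
    rw [hw_def, inv_div, add_div, mul_div_cancel_right₀ _ (hpos u hu).ne', one_div]
  have hcmp : ∀ v ≤ a, w a - y a ≤ ν v := fun v hv => by
    have hle := le_max_zero_of_hasDerivWithinAt_nonpos_of_pos (d := w - y) hv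
      (fun x hx => ((hw x hx.2).sub (hy x hx.2).2).mono Icc_subset_Iic_self)
      fun x hx hyw => ?_
    · refine hle.trans (max_le ?_ (hpos v hv).le)
      exact (sub_le_self _ (hy v hv).1.le).trans (div_le_self (hpos v hv).le (hden v hv))
    · have hinv : (w x)⁻¹ ≤ (y x)⁻¹ := inv_anti₀ (hy x hx.2).1 (sub_pos.1 hyw).le
      rw [hw_inv x hx.2] at hinv
      simp only [Pi.inv_apply]
      linarith [hslope x hx.2]
  have hwy : w a ≤ y a :=
    sub_nonpos.1 (ge_of_tendsto hlim ((eventually_le_atBot a).mono hcmp))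
  refine le_trans ?_ hwy
  rw [hw_def, le_div_iff₀ (zero_lt_one.trans_le (hden a self_mem_Iic))]
  have hcube : 0 ≤ c ^ 2 * ν a ^ 3 := by have := hpos a self_mem_Iic; positivity
  linear_combination hcube

theorem of_tendstoLocallyUniformlyOn {ι : Type*} {l : Filter ι} [l.NeBot] {Y : ι → ℝ → ℝ}
    (hs : IsOpen s) (hY : ∀ᶠ n in l, IsReducedSolutionOn r s (Y n))
    (hlim : TendstoLocallyUniformlyOn Y y l s) (hpos : ∀ u ∈ s, 0 < y u) :
    IsReducedSolutionOn r s y := by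
  have hcont : ContinuousOn y s := hlim.continuousOn
    (hY.mono fun n hn u hu => (hn u hu).2.continuousWithinAt).frequently
  have hconst : TendstoLocallyUniformlyOn (fun _ : ι => r) r l s :=
    fun _ hV _ _ => ⟨s, self_mem_nhdsWithin, .of_forall fun _ _ _ => refl_mem_uniformity hV⟩
  have hderiv := (hlim.inv₀ hcont fun u hu => (hpos u hu).ne').sub hconst
  refine fun u hu => ⟨hpos u hu, HasDerivAt.hasDerivWithinAt ?_⟩
  exact hasDerivAt_of_tendstoLocallyUniformlyOn hs hderiv
    (hY.mono fun n hn x hx => (hn x hx).2.hasDerivAt (hs.mem_nhds hx))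
    (fun x hx => hlim.tendsto_at hx) hu

end IsReducedSolutionOn

theorem exists_forall_mem_Icc_hasDerivWithinAt_of_lipschitzWith {E : Type*}
    [NormedAddCommGroup E] [NormedSpace ℝ E] [CompleteSpace E] {f : ℝ → E → E} {a b : ℝ}
    (hab : a ≤ b) {K C : NNReal} (hlip : ∀ t ∈ Icc a b, LipschitzWith K (f t))
    (hcont : ∀ x, ContinuousOn (f · x) (Icc a b)) (hbound : ∀ t ∈ Icc a b, ∀ x, ‖f t x‖ ≤ C)
    (x₀ : E) : ∃ α : ℝ → E, α a = x₀ ∧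
      ∀ t ∈ Icc a b, HasDerivWithinAt α (f t (α t)) (Icc a b) t := by
  have hpl : IsPicardLindelof f ⟨a, left_mem_Icc.2 hab⟩ x₀ (C * (b - a).toNNReal) 0 C K :=
    { lipschitzOnWith := fun t ht => (hlip t ht).lipschitzOnWith
      continuousOn := fun x _ => hcont x
      norm_le := fun t ht x _ => hbound t ht x
      mul_max_le := by simp [hab] }
  exact hpl.exists_eq_forall_mem_Icc_hasDerivWithinAt₀

theorem lipschitzWith_inv_max {δ : NNReal} (hδ : 0 < δ) :
    LipschitzWith (δ⁻¹ ^ 2) fun x : ℝ => (max x δ)⁻¹ := by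
  refine LipschitzWith.of_dist_le_mul fun x z => ?_
  have hδ' : (0 : ℝ) < δ := hδ
  have hpos : ∀ w : ℝ, 0 < max w δ := fun w => hδ'.trans_le (le_max_right _ _)
  have hinv : ∀ w : ℝ, (max w δ)⁻¹ ≤ (δ : ℝ)⁻¹ := fun w => inv_anti₀ hδ' (le_max_right _ _)
  calc dist (max x δ)⁻¹ (max z δ)⁻¹
      = (max x δ)⁻¹ * (max z δ)⁻¹ * |max x δ - max z δ| := by
        rw [dist_inv_inv₀ (hpos x).ne' (hpos z).ne', Real.dist_eq, Real.norm_of_nonneg (hpos x).le,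
          Real.norm_of_nonneg (hpos z).le]
        field_simp
    _ ≤ (δ : ℝ)⁻¹ * (δ : ℝ)⁻¹ * |x - z| := by
        have hz := inv_nonneg.2 (hpos z).le
        exact mul_le_mul (mul_le_mul (hinv x) (hinv z) hz (by positivity))
          (abs_max_sub_max_le_abs _ _ _) (abs_nonneg _) (by positivity)
    _ = ↑(δ⁻¹ ^ 2) * dist x z := by rw [Real.dist_eq]; push_cast; ring

/-- Truncating `1 / y` at height `δ⁻¹ ≥ sup |r|` makes the vector field globally Lipschitz. The
truncation is never active because the field points upwards below `δ`. -/
theorem exists_isReducedSolutionOn_Icc {r : ℝ → ℝ} {a b y₀ : ℝ} (hab : a ≤ b)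
    (hr : ContinuousOn r (Icc a b)) (hy₀ : 0 < y₀) :
    ∃ y, y a = y₀ ∧ IsReducedSolutionOn r (Icc a b) y := by
  obtain ⟨R, hR0, hR⟩ := (isCompact_Icc.image_of_continuousOn hr).isBounded.exists_pos_norm_le
  replace hR : ∀ u ∈ Icc a b, ‖r u‖ ≤ R := fun u hu => hR _ (mem_image_of_mem r hu)
  obtain ⟨δ, hδ0, hδy, hδR⟩ : ∃ δ : NNReal, 0 < δ ∧ (δ : ℝ) ≤ y₀ ∧ R ≤ (δ : ℝ)⁻¹ := by
    refine ⟨⟨min y₀ R⁻¹, by positivity⟩, ?_, min_le_left _ _, ?_⟩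
    · exact lt_min hy₀ (inv_pos.2 hR0)
    · exact le_inv_of_le_inv₀ (lt_min hy₀ (inv_pos.2 hR0)) (min_le_right _ _)
  have hδ0' : (0 : ℝ) < δ := hδ0
  have hfield : ∀ u ∈ Icc a b, ∀ x : ℝ, ‖(max x (δ : ℝ))⁻¹ - r u‖ ≤ (δ : ℝ)⁻¹ + R := by
    intro u hu x
    have hinv : ‖(max x (δ : ℝ))⁻¹‖ ≤ (δ : ℝ)⁻¹ := by
      rw [Real.norm_of_nonneg (by positivity)]
      exact inv_anti₀ hδ0' (le_max_right _ _)
    exact (norm_sub_le _ _).trans (add_le_add hinv (hR u hu))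
  obtain ⟨y, hya, hy⟩ := exists_forall_mem_Icc_hasDerivWithinAt_of_lipschitzWith hab
    (f := fun u (x : ℝ) => (max x (δ : ℝ))⁻¹ - r u) (K := δ⁻¹ ^ 2)
    (C := ⟨(δ : ℝ)⁻¹ + R, by positivity⟩)
    (fun u _ => by simpa using (lipschitzWith_inv_max hδ0).sub (.const (r u)))
    (fun x => continuousOn_const.sub hr) hfield y₀
  have hge : ∀ u ∈ Icc a b, (δ : ℝ) ≤ y u := fun u hu => by
    have hcmp := le_max_zero_of_hasDerivWithinAt_nonpos_of_pos (d := fun x => δ - y x) hu.1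
      (fun x hx => ((hy x ⟨hx.1, hx.2.trans hu.2⟩).mono
        (Icc_subset_Icc_right hu.2)).const_sub (δ : ℝ)) fun x hx hlt => ?_
    · rw [max_eq_right (by linarith)] at hcmp
      linarith
    · rw [max_eq_right (by linarith)]
      linarith [le_of_abs_le (hR x ⟨hx.1, hx.2.trans hu.2⟩)]
  refine ⟨y, hya, fun u hu => ⟨hδ0'.trans_le (hge u hu), ?_⟩⟩
  simpa only [max_eq_left (hge u hu)] using hy u hu

/-- A sequence of approximations to a global solution that stays below the nullcline `r y = 1`:
`Y n` solves the reduced equation on `[-n, n]` and starts on or below the nullcline. -/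
structure IsApproxSequence (r : ℝ → ℝ) (Y : ℕ → ℝ → ℝ) : Prop where
  isReducedSolutionOn : ∀ n : ℕ, IsReducedSolutionOn r (Icc (-n) n) (Y n)
  mul_start_le_one : ∀ n : ℕ, r (-n) * Y n (-n) ≤ 1

theorem exists_isApproxSequence {r : ℝ → ℝ} (hr : Continuous r) (hr0 : ∀ u, 0 ≤ r u) :
    ∃ Y, IsApproxSequence r Y := by
  have hstart : ∀ n : ℕ, 0 < r (-n) + 1 := fun n => by linarith [hr0 (-n)]
  choose Y hY0 hY using fun n : ℕ => exists_isReducedSolutionOn_Icc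
    (neg_le_self n.cast_nonneg : -(n : ℝ) ≤ n) hr.continuousOn (inv_pos.2 (hstart n))
  refine ⟨Y, hY, fun n => ?_⟩
  rw [hY0, ← div_eq_mul_inv, div_le_one (hstart n)]
  linarith

namespace IsApproxSequence

variable {r : ℝ → ℝ} {Y : ℕ → ℝ → ℝ}

theorem mul_le_one (hY : IsApproxSequence r Y) (hr : Antitone r) (hr0 : ∀ u, 0 ≤ r u) {n : ℕ}
    {u : ℝ} (hu : u ∈ Icc (-n : ℝ) n) : r u * Y n u ≤ 1 :=
  ((hY.isReducedSolutionOn n).mono (Icc_subset_Icc_right hu.2)).mul_le_one hu.1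
    (hr.antitoneOn _) (hr0 u) (hY.mul_start_le_one n)

theorem uniformCauchySeqOn (hY : IsApproxSequence r Y) (hr : Antitone r) (hr0 : ∀ u, 0 ≤ r u)
    (hr_top : Tendsto r atBot atTop) (T : ℝ) : UniformCauchySeqOn Y atTop (Icc (-T) T) := by
  rw [Metric.uniformCauchySeqOn_iff]
  intro ε hε
  obtain ⟨N, hrN, hTN⟩ : ∃ N : ℕ, ε⁻¹ < r (-N) ∧ T ≤ N :=
    (((hr_top.comp (tendsto_neg_atTop_atBot.comp tendsto_natCast_atTop_atTop)).eventually_gt_atTop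
      ε⁻¹).and (tendsto_natCast_atTop_atTop.eventually_ge_atTop T)).exists
  have hsub : ∀ n ≥ N, ∀ u ∈ Icc (-T) T, Icc (-N : ℝ) u ⊆ Icc (-n) n := fun n hn u hu => by
    have hn' : (N : ℝ) ≤ n := by exact_mod_cast hn
    exact Icc_subset_Icc (by linarith) (by linarith [hu.2])
  have hstart : ∀ n ≥ N, ∀ u ∈ Icc (-T) T, Y n (-N) ∈ Ioo 0 ε := fun n hn u hu => by
    have hmem : (-N : ℝ) ∈ Icc (-n : ℝ) n :=
      hsub n hn u hu (left_mem_Icc.2 (by linarith [hu.1]))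
    refine ⟨(hY.isReducedSolutionOn n _ hmem).1, ?_⟩
    have hle : Y n (-N) ≤ (r (-N))⁻¹ :=
      (le_inv_mul_iff₀ ((inv_pos.2 hε).trans hrN)).2 (hY.mul_le_one hr hr0 hmem) |>.trans_eq
        (mul_one _)
    exact hle.trans_lt (inv_lt_of_inv_lt₀ hε hrN)
  refine ⟨N, fun m hm n hn u hu => ?_⟩
  have hcontr := ((hY.isReducedSolutionOn m).mono (hsub m hm u hu)).abs_sub_le
    (by linarith [hu.1]) ((hY.isReducedSolutionOn n).mono (hsub n hn u hu))
  have hm0 := hstart m hm u hu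
  have hn0 := hstart n hn u hu
  exact hcontr.trans_lt (abs_sub_lt_of_nonneg_of_lt hm0.1.le hm0.2 hn0.1.le hn0.2)

theorem exists_tendstoLocallyUniformly (hY : IsApproxSequence r Y) (hr : Antitone r)
    (hr0 : ∀ u, 0 ≤ r u) (hr_top : Tendsto r atBot atTop) :
    ∃ y, TendstoLocallyUniformly Y y atTop := by
  have hCauchy := hY.uniformCauchySeqOn hr hr0 hr_top
  have hmem : ∀ u : ℝ, u ∈ Icc (-|u|) |u| := fun u => ⟨neg_abs_le u, le_abs_self u⟩
  choose y hy using fun u => cauchySeq_tendsto_of_complete ((hCauchy |u|).cauchySeq (hmem u))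
  refine ⟨y, tendstoLocallyUniformly_iff_forall_isCompact.2 fun K hK => ?_⟩
  obtain ⟨T, hT⟩ := hK.isBounded.subset_closedBall 0
  rw [Real.closedBall_eq_Icc, zero_sub, zero_add] at hT
  exact ((hCauchy T).tendstoUniformlyOn_of_tendsto fun u _ => hy u).mono hT

end IsApproxSequence

theorem exists_isReducedSolutionOn_univ {r : ℝ → ℝ} (hrc : Continuous r) (hr : Antitone r)
    (hr0 : ∀ u, 0 ≤ r u) (hr_top : Tendsto r atBot atTop) :
    ∃ y, IsReducedSolutionOn r univ y ∧ ∀ u, r u * y u ≤ 1 := by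
  obtain ⟨Y, hY⟩ := exists_isApproxSequence hrc hr0
  obtain ⟨y, hlim⟩ := hY.exists_tendstoLocallyUniformly hr hr0 hr_top
  have hpt : ∀ u, Tendsto (Y · u) atTop (𝓝 (y u)) := fun u =>
    (tendstoLocallyUniformlyOn_univ.2 hlim).tendsto_at (mem_univ u)
  have hlarge : ∀ T : ℝ, ∀ᶠ n : ℕ in atTop, Icc (-T) T ⊆ Icc (-n) n := fun T => by
    filter_upwards [tendsto_natCast_atTop_atTop.eventually_ge_atTop T] with n hn
    exact Icc_subset_Icc (neg_le_neg hn) hn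
  have hpos : ∀ u, 0 < y u := fun u => by
    have hr1 : 0 < r (u - 1) + 1 := by linarith [hr0 (u - 1)]
    refine (inv_pos.2 hr1).trans_le (ge_of_tendsto (hpt u) ?_)
    filter_upwards [hlarge (|u| + 1)] with n hn
    refine ((hY.isReducedSolutionOn n).mono (Subset.trans ?_ hn)).inv_add_one_le (hr0 _)
      fun x hx => hr hx.1
    exact Icc_subset_Icc (by linarith [neg_abs_le u]) (by linarith [le_abs_self u])
  refine ⟨y, fun u _ => ?_, fun u => ?_⟩
  · have hsol : IsReducedSolutionOn r (Ioo (-(|u| + 1)) (|u| + 1)) y :=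
      .of_tendstoLocallyUniformlyOn isOpen_Ioo
        ((hlarge _).mono fun n hn => (hY.isReducedSolutionOn n).mono (Ioo_subset_Icc_self.trans hn))
        (tendstoLocallyUniformlyOn_univ.2 hlim |>.mono (subset_univ _)) fun x _ => hpos x
    have hmem : u ∈ Ioo (-(|u| + 1)) (|u| + 1) := abs_lt.1 (lt_add_one |u|)
    exact ⟨hpos u, ((hsol u hmem).2.hasDerivAt (isOpen_Ioo.mem_nhds hmem)).hasDerivWithinAt⟩
  · refine le_of_tendsto ((hpt u).const_mul (r u)) ?_
    filter_upwards [hlarge |u|] with n hn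
    exact hY.mul_le_one hr hr0 (hn ⟨neg_abs_le u, le_abs_self u⟩)

theorem exists_isReducedSolutionOn_Iic {r : ℝ → ℝ} {b : ℝ} (hrc : ContinuousOn r (Iic b))
    (hr : AntitoneOn r (Iic b)) (hrb : 0 ≤ r b) (hr_top : Tendsto r atBot atTop) :
    ∃ y, IsReducedSolutionOn r (Iic b) y ∧ ∀ u ≤ b, r u * y u ≤ 1 := by
  have hext : EqOn (fun u => r (min u b)) r (Iic b) := fun u hu => congrArg r (min_eq_left hu)
  obtain ⟨y, hy, hle⟩ := exists_isReducedSolutionOn_univ (r := fun u => r (min u b))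
    (hrc.comp_continuous (by fun_prop) fun u => min_le_right u b)
    (fun u v huv => hr (min_le_right u b) (min_le_right v b) (min_le_min_right b huv))
    (fun u => hrb.trans (hr (min_le_right u b) self_mem_Iic (min_le_right u b)))
    (hr_top.congr' ((eventually_le_atBot b).mono fun u hu => (hext hu).symm))
  exact ⟨y, (hy.mono (subset_univ _)).congr hext, fun u hu => hext hu ▸ hle u⟩

section SolutionsAndGaps

variable {g g' r η y : ℝ → ℝ} {s : Set ℝ} {a : ℝ}

theorem IsReducedSolutionOn.isSolutionOn_sub (hy : IsReducedSolutionOn r s y)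
    (hg : ∀ u ∈ s, HasDerivWithinAt g (-r u) s u) : IsSolutionOn g s (y - g) := fun u hu => by
  have hgap : (y - g) u + g u = y u := sub_add_cancel _ _
  refine ⟨hgap ▸ (hy u hu).1.ne', ?_⟩
  rw [hgap, one_div]
  simpa only [sub_neg_eq_add, sub_add_cancel] using (hy u hu).2.sub (hg u hu)

namespace IsSolutionOn

theorem hasDerivWithinAt_add (hη : IsSolutionOn g s η)
    (hg : ∀ u ∈ s, HasDerivWithinAt g (-r u) s u) :
    ∀ u ∈ s, HasDerivWithinAt (η + g) (((η + g) u)⁻¹ - r u) s u := fun u hu => by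
  refine ((hη u hu).2.add (hg u hu)).congr_deriv ?_
  rw [one_div, ← sub_eq_add_neg, Pi.add_apply]

/-- A negative gap would decrease at unit speed once it is close to its limit `0`. -/
theorem add_pos_of_tendsto (hη : IsSolutionOn g (Iic a) η)
    (hg : ∀ u ∈ Iic a, HasDerivWithinAt g (-r u) (Iic a) u) (hr : ∀ u ∈ Iic a, 0 ≤ r u)
    (hlim : Tendsto (η + g) atBot (𝓝 0)) : ∀ u ∈ Iic a, 0 < (η + g) u := by
  have hderiv := hη.hasDerivWithinAt_add hg
  intro u hu
  by_contra! hneg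
  have hneg_all : ∀ x ∈ Iic a, (η + g) x < 0 := fun x hx => by
    by_contra! hx0
    obtain ⟨v, hv, hv0⟩ := isPreconnected_Iic.intermediate_value hu hx
      (fun x hx => (hderiv x hx).continuousWithinAt) ⟨hneg, hx0⟩
    exact (hη v hv).1 hv0
  obtain ⟨b, hba, hb⟩ := ((eventually_le_atBot a).and
    (eventually_forall_le_atBot.2 (hlim.eventually_const_lt neg_one_lt_zero))).exists
  have hsub : Icc (b - 1) b ⊆ Iic a := fun x hx => hx.2.trans hba
  have hcmp := le_max_zero_of_hasDerivWithinAt_nonpos_of_pos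
    (d := fun x => (η + g) x + (x - (b - 1))) (by linarith)
    (fun x hx => ((hderiv x (hsub hx)).mono hsub).add
      ((hasDerivWithinAt_id x _).sub_const (b - 1))) fun x hx _ => ?_
  · have hstart := hneg_all (b - 1) (hsub ⟨le_rfl, by linarith⟩)
    rw [max_eq_right (by linarith)] at hcmp
    linarith [hb b le_rfl]
  · have hinv : ((η + g) x)⁻¹ ≤ -1 := by
      rw [inv_le_of_neg (hneg_all x (hsub hx)) neg_one_lt_zero]
      simpa only [inv_neg, inv_one] using (hb x hx.2).le
    linarith [hr x (hsub hx)]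

theorem isReducedSolutionOn_add (hη : IsSolutionOn g (Iic a) η)
    (hg : ∀ u ∈ Iic a, HasDerivWithinAt g (-r u) (Iic a) u) (hr : ∀ u ∈ Iic a, 0 ≤ r u)
    (hlim : Tendsto (η + g) atBot (𝓝 0)) : IsReducedSolutionOn r (Iic a) (η + g) :=
  fun u hu => ⟨hη.add_pos_of_tendsto hg hr hlim u hu, hη.hasDerivWithinAt_add hg u hu⟩

end IsSolutionOn

end SolutionsAndGaps

theorem hasDerivAt_neg_pow (n : ℕ) (u : ℝ) :
    HasDerivAt (fun u : ℝ => (-u) ^ n) (-(n * (-u) ^ (n - 1))) u := by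
  simpa using (hasDerivAt_neg u).fun_pow n

theorem hasDerivAt_inv_neg_pow (n : ℕ) {u : ℝ} (hu : u ≠ 0) :
    HasDerivAt (fun u : ℝ => ((-u) ^ n)⁻¹) (n / (-u) ^ (n + 1)) u := by
  have hu' : -u ≠ 0 := neg_ne_zero.2 hu
  refine ((hasDerivAt_neg_pow n u).fun_inv (pow_ne_zero n hu')).congr_deriv ?_
  rcases n with _ | n
  · simp
  · simp only [Nat.add_sub_cancel, neg_neg]
    field_simp
    ring

theorem tendsto_inv_neg_pow_atBot {n : ℕ} (hn : n ≠ 0) :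
    Tendsto (fun u : ℝ => ((-u) ^ n)⁻¹) atBot (𝓝 0) :=
  ((tendsto_pow_atTop hn).comp tendsto_neg_atBot_atTop).inv_tendsto_atTop

/-- The asymptotic expansion at `-∞` of the solution whose gap to the curve `η = -(-u) ^ p` tends to
`0`. It is written in powers of `-u`, so that it covers even and odd `p` at once. -/
def HasSlowExpansion (p : ℕ) (η : ℝ → ℝ) : Prop :=
  (fun u : ℝ => η u - (-(-u) ^ p + 1 / p * (1 / (-u) ^ (p - 1)))) =O[atBot]
    fun u : ℝ => 1 / (-u) ^ (3 * p - 2)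

theorem hasEvenExpansion_iff {p : ℕ} {η : ℝ → ℝ} (hp : Even p) (hp0 : p ≠ 0) :
    HasEvenExpansion p η ↔ HasSlowExpansion p η := by
  have hpred : Odd (p - 1) := by grind
  have herr : Even (3 * p - 2) := by grind
  simp only [HasEvenExpansion, HasSlowExpansion, hp.neg_pow, hpred.neg_pow, herr.neg_pow, div_neg,
    mul_neg, sub_eq_add_neg]

theorem hasOddExpansion_iff {p : ℕ} {η : ℝ → ℝ} (hp : Odd p) :
    HasOddExpansion p η ↔ HasSlowExpansion p η := by
  have hpred : Even (p - 1) := by grind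
  have herr : Odd (3 * p - 2) := by grind
  simp only [HasOddExpansion, HasSlowExpansion, hp.neg_pow, hpred.neg_pow, herr.neg_pow, neg_neg,
    div_neg, isBigO_neg_right]

theorem HasSlowExpansion.tendsto_add {p : ℕ} {η : ℝ → ℝ} (hp : 2 ≤ p)
    (hη : HasSlowExpansion p η) : Tendsto (η + fun u => (-u) ^ p) atBot (𝓝 0) := by
  have hmain : Tendsto (fun u : ℝ => 1 / (p : ℝ) * (1 / (-u) ^ (p - 1))) atBot (𝓝 0) := by
    simpa only [one_div, mul_zero] using
      (tendsto_inv_neg_pow_atBot (by lia : p - 1 ≠ 0)).const_mul (p : ℝ)⁻¹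
  have herr := hη.trans_tendsto <| by
    simpa only [one_div] using tendsto_inv_neg_pow_atBot (by lia : 3 * p - 2 ≠ 0)
  refine (by simpa only [add_zero] using herr.add hmain : Tendsto _ _ (𝓝 (0 : ℝ))).congr fun u => ?_
  simp only [Pi.add_apply]
  ring

section Power

variable {p : ℕ} {y : ℝ → ℝ}

theorem exists_isReducedSolutionOn_neg_pow (hp : 2 ≤ p) :
    ∃ y, IsReducedSolutionOn (fun u => p * (-u) ^ (p - 1)) (Iic 0) y ∧
      ∀ u < 0, y u ≤ 1 / p * (1 / (-u) ^ (p - 1)) := by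
  have hp0 : (0 : ℝ) < p := by positivity
  obtain ⟨y, hy, hle⟩ := exists_isReducedSolutionOn_Iic (b := 0)
    (r := fun u : ℝ => p * (-u) ^ (p - 1)) (by fun_prop)
    (fun u _ v hv huv => mul_le_mul_of_nonneg_left
      (pow_le_pow_left₀ (neg_nonneg.2 hv) (neg_le_neg huv) _) hp0.le)
    (by positivity)
    (((tendsto_pow_atTop (by lia : p - 1 ≠ 0)).comp tendsto_neg_atBot_atTop).const_mul_atTop hp0)
  refine ⟨y, hy, fun u hu => ?_⟩
  have hpow : 0 < (-u) ^ (p - 1) := pow_pos (neg_pos.2 hu) _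
  rw [one_div_mul_one_div, le_div_iff₀' (by positivity)]
  exact hle u hu.le

/-- The error term `ν' ν ^ 2` of `IsReducedSolutionOn.sub_mul_sq_le` for `ν = 1 / (p v ^ (p - 1))`,
where `v = -u`. -/
theorem inv_mul_sq_le_one_div_pow (hp : p ≠ 0) {v : ℝ} (hv : 0 < v) :
    (p : ℝ)⁻¹ * ((p - 1 : ℕ) / v ^ p) * ((p : ℝ)⁻¹ * (v ^ (p - 1))⁻¹) ^ 2 ≤
      1 / v ^ (3 * p - 2) := by
  have hp1 : 1 ≤ (p : ℝ) := by exact_mod_cast Nat.one_le_iff_ne_zero.2 hp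
  have hexp : v ^ (3 * p - 2) = v ^ p * (v ^ (p - 1)) ^ 2 := by
    rw [← pow_mul, ← pow_add]
    congr 1
    lia
  have hcoeff : (p : ℝ)⁻¹ ^ 3 * (p - 1 : ℕ) ≤ 1 :=
    calc (p : ℝ)⁻¹ ^ 3 * (p - 1 : ℕ) ≤ (p : ℝ)⁻¹ * p := by
          gcongr
          · exact pow_le_of_le_one (by positivity) (inv_le_one_of_one_le₀ hp1) three_ne_zero
          · exact Nat.sub_le p 1
      _ = 1 := inv_mul_cancel₀ (by positivity)
  calc (p : ℝ)⁻¹ * ((p - 1 : ℕ) / v ^ p) * ((p : ℝ)⁻¹ * (v ^ (p - 1))⁻¹) ^ 2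
      = (p : ℝ)⁻¹ ^ 3 * (p - 1 : ℕ) * (1 / v ^ (3 * p - 2)) := by
        rw [hexp]
        field_simp
    _ ≤ 1 / v ^ (3 * p - 2) := mul_le_of_le_one_left (by positivity) hcoeff

theorem IsReducedSolutionOn.one_div_mul_one_div_sub_le (hp : 2 ≤ p)
    (hy : IsReducedSolutionOn (fun u => p * (-u) ^ (p - 1)) (Iic 0) y) {u : ℝ} (hu : u < 0) :
    1 / p * (1 / (-u) ^ (p - 1)) - 1 / (-u) ^ (3 * p - 2) ≤ y u := by
  set ν : ℝ → ℝ := fun x => (p : ℝ)⁻¹ * ((-x) ^ (p - 1))⁻¹ with hν_def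
  set ν' : ℝ → ℝ := fun x => (p : ℝ)⁻¹ * ((p - 1 : ℕ) / (-x) ^ p) with hν'_def
  have hp1 : p - 1 + 1 = p := by lia
  have hu0 : 0 < -u := neg_pos.2 hu
  have hνpos : ∀ x ∈ Iic u, 0 < ν x := fun x hx => by
    have hx0 : 0 < -x := neg_pos.2 (hx.trans_lt hu)
    positivity
  have hν'u : 0 ≤ ν' u := by positivity
  have hsub : ν u - ν' u * ν u ^ 2 ≤ y u := by
    refine IsReducedSolutionOn.sub_mul_sq_le hν'u (ν' := ν') (fun x hx => ?_) hνpos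
      (fun x hx => ?_) ?_ ((hy.mono (Iic_subset_Iic.2 hu.le)).congr fun x _ => ?_)
    · simpa only [hp1] using ((hasDerivAt_inv_neg_pow (p - 1)
        (hx.trans_lt hu).ne).const_mul (p : ℝ)⁻¹).hasDerivWithinAt
    · have hux : -u ≤ -x := neg_le_neg hx
      simp only [hν'_def]
      gcongr
    · simpa only [mul_zero] using
        (tendsto_inv_neg_pow_atBot (by lia : p - 1 ≠ 0)).const_mul (p : ℝ)⁻¹
    · simp only [hν_def, Pi.inv_apply, mul_inv, inv_inv]
  have herr : ν' u * ν u ^ 2 ≤ 1 / (-u) ^ (3 * p - 2) :=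
    inv_mul_sq_le_one_div_pow (by lia) hu0
  have hν_eq : ν u = 1 / p * (1 / (-u) ^ (p - 1)) := by simp only [hν_def, one_div]
  linarith

theorem IsReducedSolutionOn.hasSlowExpansion_sub (hp : 2 ≤ p)
    (hy : IsReducedSolutionOn (fun u => p * (-u) ^ (p - 1)) (Iic 0) y)
    (hle : ∀ u < 0, y u ≤ 1 / p * (1 / (-u) ^ (p - 1))) :
    HasSlowExpansion p (y - fun u => (-u) ^ p) := by
  refine IsBigO.of_bound 1 ((eventually_lt_atBot 0).mono fun u hu => ?_)
  have hu0 : 0 < -u := neg_pos.2 hu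
  rw [one_mul, Real.norm_of_nonneg (by positivity : 0 ≤ 1 / (-u) ^ (3 * p - 2)), Real.norm_eq_abs,
    abs_le, Pi.sub_apply]
  have herr : 0 ≤ 1 / (-u) ^ (3 * p - 2) := by positivity
  constructor <;> linarith [hle u hu, hy.one_div_mul_one_div_sub_le hp hu]

end Power

theorem mainTheorem2_general {p : ℕ} (hp : 2 ≤ p) :
    ∃ η₀ : ℝ → ℝ,
      IsSolutionOn (fun u => (-u) ^ p) (Iic 0) η₀ ∧ HasSlowExpansion p η₀ ∧
      (∀ a ≤ 0, ∀ η : ℝ → ℝ, IsSolutionOn (fun u => (-u) ^ p) (Iic a) η →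
        Tendsto (fun u => η u + (-u) ^ p) atBot (𝓝 0) → EqOn η η₀ (Iic a)) ∧
      (∀ u ≤ 0, -(-u) ^ p < η₀ u) ∧
      ∀ K : ℝ, 1 / (p : ℝ) < K → ∀ u < 0, η₀ u < -(-u) ^ p + K / (-u) ^ (p - 1) := by
  set g : ℝ → ℝ := fun u => (-u) ^ p with hg_def
  have hg : ∀ (s : Set ℝ), ∀ u ∈ s, HasDerivWithinAt g (-(p * (-u) ^ (p - 1))) s u :=
    fun s u _ => (hasDerivAt_neg_pow p u).hasDerivWithinAt
  obtain ⟨y, hy, hle⟩ := exists_isReducedSolutionOn_neg_pow hp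
  have hexp : HasSlowExpansion p (y - g) := hy.hasSlowExpansion_sub hp hle
  have hy_lim : Tendsto y atBot (𝓝 0) := sub_add_cancel y g ▸ hexp.tendsto_add hp
  refine ⟨y - g, hy.isSolutionOn_sub (hg _), hexp, fun a ha η hη hlim => ?_, fun u hu => ?_,
    fun K hK u hu => ?_⟩
  · have hgap : IsReducedSolutionOn (fun u => p * (-u) ^ (p - 1)) (Iic a) (η + g) := by
      refine hη.isReducedSolutionOn_add (hg _) (fun u hu => ?_) hlim
      exact mul_nonneg p.cast_nonneg (pow_nonneg (neg_nonneg.2 (hu.trans ha)) _)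
    have heq : EqOn (η + g) y (Iic a) :=
      hgap.eqOn_of_tendsto_sub (hy.mono (Iic_subset_Iic.2 ha))
        (sub_zero (0 : ℝ) ▸ hlim.sub hy_lim)
    exact fun u hu => eq_sub_of_add_eq (heq hu)
  · simpa [hg_def] using (hy u hu).1
  · have hpow : 0 < (-u) ^ (p - 1) := pow_pos (neg_pos.2 hu) _
    have hK' : 1 / p * (1 / (-u) ^ (p - 1)) < K / (-u) ^ (p - 1) := by
      rw [mul_one_div]
      exact div_lt_div_of_pos_right hK hpow
    simp only [Pi.sub_apply, hg_def]
    linarith [hle u hu]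

theorem mainTheorem2 :
    (∀ p : ℕ, Even p → 2 ≤ p →
      ∃ η₀ : ℝ → ℝ,
        IsSolutionOn (fun u => u ^ p) (Set.Iic 0) η₀ ∧ HasEvenExpansion p η₀ ∧
        (∀ a : ℝ, a ≤ 0 → ∀ η : ℝ → ℝ,
          IsSolutionOn (fun u => u ^ p) (Set.Iic a) η → HasEvenExpansion p η →
            Set.EqOn η η₀ (Set.Iic a)) ∧
        ∃ K : ℝ, 1 / (p : ℝ) < K ∧
          (∀ u : ℝ, u ≤ 0 → -u ^ p < η₀ u) ∧
          (∀ u : ℝ, u < 0 → η₀ u < -u ^ p - K / u ^ (p - 1))) ∧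
    (∀ p : ℕ, Odd p → 3 ≤ p →
      ∃ η₀ : ℝ → ℝ,
        IsSolutionOn (fun u => -u ^ p) (Set.Iic 0) η₀ ∧ HasOddExpansion p η₀ ∧
        (∀ a : ℝ, a ≤ 0 → ∀ η : ℝ → ℝ,
          IsSolutionOn (fun u => -u ^ p) (Set.Iic a) η → HasOddExpansion p η →
            Set.EqOn η η₀ (Set.Iic a)) ∧
        ∃ K : ℝ, 1 / (p : ℝ) < K ∧
          (∀ u : ℝ, u ≤ 0 → u ^ p < η₀ u) ∧
          (∀ u : ℝ, u < 0 → η₀ u < u ^ p + K / u ^ (p - 1))) := by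
  have hone : ∀ p : ℕ, 2 ≤ p → 1 / (p : ℝ) < 1 := fun p hp =>
    (div_lt_one (by positivity)).2 (by exact_mod_cast hp)
  refine ⟨fun p hpar hp => ?_, fun p hpar hp3 => ?_⟩
  · obtain ⟨η₀, hsol, hexp, huniq, hlow, hup⟩ := mainTheorem2_general hp
    have hpred : Odd (p - 1) := by grind
    refine ⟨η₀, by simpa only [hpar.neg_pow] using hsol,
      (hasEvenExpansion_iff hpar (by lia)).2 hexp, fun a ha η hη hη' => ?_, 1, hone p hp,
      by simpa only [hpar.neg_pow] using hlow, ?_⟩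
    · exact huniq a ha η (by simpa only [hpar.neg_pow] using hη)
        (((hasEvenExpansion_iff hpar (by lia)).1 hη').tendsto_add hp)
    · simpa only [hpar.neg_pow, hpred.neg_pow, div_neg, ← sub_eq_add_neg] using hup 1 (hone p hp)
  · have hp : 2 ≤ p := by lia
    obtain ⟨η₀, hsol, hexp, huniq, hlow, hup⟩ := mainTheorem2_general hp
    have hpred : Even (p - 1) := by grind
    refine ⟨η₀, by simpa only [hpar.neg_pow] using hsol,
      (hasOddExpansion_iff hpar).2 hexp, fun a ha η hη hη' => ?_, 1, hone p hp,
      by simpa only [hpar.neg_pow, neg_neg] using hlow, ?_⟩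
    · exact huniq a ha η (by simpa only [hpar.neg_pow] using hη)
        (((hasOddExpansion_iff hpar).1 hη').tendsto_add hp)
    · simpa only [hpar.neg_pow, hpred.neg_pow, neg_neg] using hup 1 (hone p hp)
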